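/- Two base stations (BSs) $i\in\{1,2\}$, each with a storage of capacity $S_{\max}\ge 0$, operate over time steps $t=1,\dots,N$. Let $0\le\alpha\le1$ be the storage efficiency and $0\le\beta\le1$ the transfer efficiency. The net energies $(E_1(t),E_2(t))$ form a real-valued stochastic process with an arbitrary joint distribution $F$. At time $t$ the controls are $w_i(t)\ge0$ (grid energy), $c_i(t)\ge0$ (charge), $d_i(t)\ge0$ (discharge), and $x_{12}(t),x_{21}(t)\ge0$ (transfers), chosen as measurable functions of $E(1),\dots,E(t)$. The storage levels satisfy $s_i(1)=0$, $s_i(t+1)=s_i(t)+\alpha c_i(t)-d_i(t)$, and the following must hold almost surely for $1\le t\le N$: $$0\le s_i(t),\,s_i(t+1)\le S_{\max},\quad d_i(t)\le s_i(t),\quad c_i(t)d_i(t)=0,\quad x_{12}(t)x_{21}(t)=0,$$ $$E_1+w_1-c_1+\alpha d_1-x_{12}+\beta x_{21}\ge0,\qquad E_2+w_2-c_2+\alpha d_2-x_{21}+\beta x_{12}\ge0 .$$ A control policy is optimal if it minimizes $\mathbb E\big[\frac1N\sum_{t=1}^N(w_1(t)+w_2(t))\big]\in[0,\infty]$ among all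 control policies satisfying these constraints. The modified greedy policy (BS 1 in surplus) does the following at every time $t$, regardless of how $\beta$ compares with $\alpha^2$, where $s_i$, $E_i$ are the current values and all controls not mentioned are zero. 1. Set $x_{12}=\min\{E_1,|E_2|/\beta\}$ and $E_2'=E_2+\beta x_{12}$. 2. If $E_2'=0$, set $E_1'=E_1-x_{12}$ and $c_i=\min\{(S_{\max}-s_i)/\alpha,\,E_i'\}$ for $i=1,2$. If now exactly one storage $i$ has level $s_i'=s_i+\alpha c_i$ equal to $S_{\max}$, BS $i$ additionally transfers $y=E_i'-c_i$ to the other BS $j$, and $c_j$ is increased by $\min\{\beta y,(S_{\max}-s_j')/\alpha\}$. The step ends. 3. If $E_2'\ne0$, set $d_2=\min\{|E_2'|/\alpha,s_2\}$ and $E_2''=E_2'+\alpha d_2$. If $E_2''=0$, the step ends. Otherwise set $d_1=\min\{|E_2''|/(\alpha\beta),s_1\}$, increase $x_{12}$ by $\alpha d_1$, set $E_2'''=E_2''+\alpha\beta d_1$, and, if $E_2'''<0$, set $w_2=|E_2'''|$. (For $\alpha=0$ no storage is charged or discharged, and for $\beta=0$ nothing is transferred: the quantities that would involve a division by zero, and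 for $\beta=0$ also $y$, are taken to be $0$.) **Proposition.** If $E_1(t)\ge0$ and $E_2(t)\le0$ for all $1\le t\le N$ almost surely, then the modified greedy policy satisfies all constraints and is optimal. Symmetrically, if $E_2(t)\ge0$ and $E_1(t)\le0$ for all $1\le t\le N$ almost surely, then the policy obtained by swapping the roles of the two BSs is optimal. -/

import Mathlib

open MeasureTheory

/-!
Two base stations (BSs) are indexed by `Fin 2`; time steps are `t = 0, 1, …, N - 1`.
-/

namespace EnergyCoop

/-- The controls of one time step. Here `x i` is the energy sent from BS `i` to the other BS. -/
structure Control where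
  /-- energy drawn from the grid -/
  w : Fin 2 → ℝ
  /-- energy sent to the local storage -/
  c : Fin 2 → ℝ
  /-- energy taken out of the local storage -/
  d : Fin 2 → ℝ
  /-- energy sent to the other BS -/
  x : Fin 2 → ℝ

/-- The other BS. -/
def other (i : Fin 2) : Fin 2 := 1 - i

/-- A net energy profile: `e t i` is the net energy (generation minus demand) of BS `i` at time
`t`. Only the times `t < N` matter below. -/
abbrev Profile : Type := ℕ → Fin 2 → ℝ

/-- A rule that selects the controls at every time along every profile. -/
abbrev Policy : Type := ℕ → Profile → Control

/-- Storage levels after one step with storage inefficiency `α`. -/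
def nextStorage (α : ℝ) (s : Fin 2 → ℝ) (u : Control) : Fin 2 → ℝ :=
  fun i => s i + α * u.c i - u.d i

/-- The storage levels at the beginning of time step `t`; both storages are empty initially. -/
def storage (α : ℝ) (π : Policy) (e : Profile) : ℕ → Fin 2 → ℝ
  | 0 => 0
  | t + 1 => nextStorage α (storage α π e t) (π t e)

/-- The controls `u` are allowed at storage levels `s` and net energies `E`. -/
structure Feasible (α β S : ℝ) (s E : Fin 2 → ℝ) (u : Control) : Prop where
  w_nonneg : ∀ i, 0 ≤ u.w i
  c_nonneg : ∀ i, 0 ≤ u.c i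
  d_nonneg : ∀ i, 0 ≤ u.d i
  x_nonneg : ∀ i, 0 ≤ u.x i
  /-- no simultaneous charging and discharging of one storage -/
  charge_or_discharge : ∀ i, u.c i * u.d i = 0
  /-- energy is transferred in at most one direction -/
  one_way : u.x 0 * u.x 1 = 0
  discharge_le : ∀ i, u.d i ≤ s i
  next_nonneg : ∀ i, 0 ≤ nextStorage α s u i
  next_le : ∀ i, nextStorage α s u i ≤ S
  /-- energy neutralization -/
  neutral : ∀ i, 0 ≤ E i + u.w i - u.c i + α * u.d i - u.x i + β * u.x (other i)

/-- Control policies over `N` steps when the profile has joint distribution `F`: the controls at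
time `t` are measurable functions of the net energies up to time `t`, and all constraints hold
almost surely. -/
structure Admissible (α β S : ℝ) (N : ℕ) (F : Measure Profile) (π : Policy) : Prop where
  measurable_w : ∀ t < N, ∀ i, Measurable fun e => (π t e).w i
  measurable_c : ∀ t < N, ∀ i, Measurable fun e => (π t e).c i
  measurable_d : ∀ t < N, ∀ i, Measurable fun e => (π t e).d i
  measurable_x : ∀ t < N, ∀ i, Measurable fun e => (π t e).x i
  causal : ∀ t < N, ∀ e e' : Profile, (∀ k ≤ t, e k = e' k) → π t e = π t e'
  feasible : ∀ᵐ e ∂F, ∀ t < N, Feasible α β S (storage α π e t) (e t) (π t e)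

/-- The expected average energy drawn from the grid, `𝔼[(1/N) ∑ₜ (w₁(t) + w₂(t))]`, as an element
of `[0, ∞]`. -/
noncomputable def expectedCost (N : ℕ) (F : Measure Profile) (π : Policy) : ENNReal :=
  ∫⁻ e, ENNReal.ofReal
    ((1 / (N : ℝ)) * ∑ t ∈ Finset.range N, ((π t e).w 0 + (π t e).w 1)) ∂F

/-- `π` is a control policy that minimizes the expected average energy drawn from the grid. -/
def IsOptimal (α β S : ℝ) (N : ℕ) (F : Measure Profile) (π : Policy) : Prop :=
  Admissible α β S N F π ∧
    ∀ π', Admissible α β S N F π' → expectedCost N F π ≤ expectedCost N F π'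

/-!
The modified greedy policy. In the boundary cases, `α = 0` means that storages are neither charged
nor discharged, and `β = 0` that nothing is transferred; since `y / 0 = 0` in Lean, the quotients
by `α`, `β` and `α * β` below already give the value `0` that is meant there.
-/

open Classical in
/-- The rule for a step with no deficit: each BS charges its own storage; if then exactly one
storage is full, the BS with the full storage sends its remaining energy to the other BS, which
charges its storage with it as far as possible. -/
noncomputable def surplusRule (α β S : ℝ) (s E : Fin 2 → ℝ) : Control :=
  let c : Fin 2 → ℝ := fun k => min ((S - s k) / α) (E k)
  let s' : Fin 2 → ℝ := fun k => s k + α * c k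
  let share : Fin 2 → Control := fun k =>
    let x := if β = 0 then 0 else E k - c k
    { w := 0
      c := c + Pi.single (other k) (min (β * x) ((S - s' (other k)) / α))
      d := 0
      x := Pi.single k x }
  if s' 0 = S ∧ s' 1 < S then share 0
  else if s' 1 = S ∧ s' 0 < S then share 1
  else { w := 0, c := c, d := 0, x := 0 }

open Classical in
/-- The rule for a step in which BS `i` has a surplus and the other BS `j` has a deficit: first
transfer energy from `i` to `j`, then use the storage of `j`, then the storage of `i`, then the
grid. If the transfer covers the deficit, the remaining energy is treated by `surplusRule`. -/
noncomputable def transferFirstRule (α β S : ℝ) (i : Fin 2) (s E : Fin 2 → ℝ) : Control :=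
  let j := other i
  let x := min (E i) (|E j| / β)
  let E' := E j + β * x
  if E' = 0 then
    let u := surplusRule α β S s (Function.update (Function.update E i (E i - x)) j E')
    { w := u.w, c := u.c, d := u.d, x := u.x + Pi.single i x }
  else
    let dj := min (|E'| / α) (s j)
    let E'' := E' + α * dj
    if E'' = 0 then
      { w := 0, c := 0, d := Pi.single j dj, x := Pi.single i x }
    else
      let di := min (|E''| / (α * β)) (s i)
      let E''' := E'' + α * β * di
      { w := Pi.single j (if E''' < 0 then |E'''| else 0)
        c := 0
        d := Pi.single j dj + Pi.single i di
        x := Pi.single i (x + α * di) }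

/-- The storage levels when `transferFirstRule` is applied at every time step. -/
noncomputable def greedyStorage (α β S : ℝ) (i : Fin 2) (e : Profile) : ℕ → Fin 2 → ℝ
  | 0 => 0
  | t + 1 => nextStorage α (greedyStorage α β S i e t)
      (transferFirstRule α β S i (greedyStorage α β S i e t) (e t))

/-- The modified greedy policy when BS `i` is the one in surplus: apply `transferFirstRule` at
every time step, whatever the values of `α` and `β`. -/
noncomputable def modifiedGreedy (α β S : ℝ) (i : Fin 2) : Policy :=
  fun t e => transferFirstRule α β S i (greedyStorage α β S i e t) (e t)

end EnergyCoop

/-!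
Measure stored energy by what it can deliver to the BS in deficit, counting the losses `α` of
discharging and `β` of transferring. Along a fixed profile, compare any feasible policy with the
greedy one by adding, to the grid energy the greedy policy has drawn, the positive part of the
amount by which its deliverable energy falls short of the competitor's. One step never increases
this sum by more than the grid energy the competitor draws. The greedy policy gains as much
deliverable energy as any policy unless its storages fill up, and then it cannot fall short; it
draws from the grid only when nothing deliverable remains. So it is optimal along every profile.
-/

namespace EnergyCoop

theorem other_ne (i : Fin 2) : other i ≠ i := by
  fin_cases i <;> decide

theorem other_other (i : Fin 2) : other (other i) = i := by
  fin_cases i <;> decide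

theorem forall_iff_self_other (i : Fin 2) {p : Fin 2 → Prop} :
    (∀ k, p k) ↔ p i ∧ p (other i) := by
  fin_cases i <;> simp [other, Fin.forall_fin_two, and_comm]

theorem apply_zero_add_apply_one (i : Fin 2) (f : Fin 2 → ℝ) :
    f 0 + f 1 = f i + f (other i) := by
  fin_cases i <;> simp [other, add_comm]

theorem apply_zero_mul_apply_one (i : Fin 2) (f : Fin 2 → ℝ) :
    f 0 * f 1 = f i * f (other i) := by
  fin_cases i <;> simp [other, mul_comm]

theorem single_apply_nonneg (i : Fin 2) {x : ℝ} (hx : 0 ≤ x) (k : Fin 2) :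
    0 ≤ (Pi.single i x : Fin 2 → ℝ) k := by
  have h : (0 : Fin 2 → ℝ) ≤ Pi.single i x := Pi.single_nonneg.2 hx
  exact h k

theorem ite_abs_eq_neg {r : ℝ} (hr : r ≤ 0) : (if r < 0 then |r| else 0) = -r := by
  rcases hr.eq_or_lt with rfl | hr'
  · simp
  · rw [if_pos hr', abs_of_neg hr']

/-- The amount, at most `b`, of a resource that has to be spent with efficiency `a` in order to
raise the level `r` as far as possible towards `S`. Every transfer, charge and discharge of the
greedy policy has this form; it is `0` for `a = 0` when `0 ≤ b`. -/
noncomputable def topUp (a S r b : ℝ) : ℝ := min ((S - r) / a) b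

section topUp

variable {a S r b : ℝ}

theorem topUp_le : topUp a S r b ≤ b := min_le_right _ _

theorem topUp_nonneg (ha : 0 ≤ a) (hr : r ≤ S) (hb : 0 ≤ b) : 0 ≤ topUp a S r b :=
  le_min (div_nonneg (sub_nonneg.2 hr) ha) hb

theorem topUp_zero_right (ha : 0 ≤ a) (hr : r ≤ S) : topUp a S r 0 = 0 :=
  le_antisymm topUp_le (topUp_nonneg ha hr le_rfl)

theorem min_abs_div_eq_topUp (hr : r ≤ 0) : min (|r| / a) b = topUp a 0 r b := by
  rw [topUp, zero_sub, abs_of_nonpos hr]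

theorem topUp_self (hb : 0 ≤ b) : topUp a S S b = 0 := by
  simp [topUp, hb]

theorem add_mul_topUp (ha : 0 ≤ a) (hr : r ≤ S) : r + a * topUp a S r b = min S (r + a * b) := by
  rcases ha.eq_or_lt with rfl | ha
  · simp [hr]
  · rw [topUp, mul_min_of_nonneg _ _ ha.le, mul_div_cancel₀ _ ha.ne', ← min_add_add_left,
      add_sub_cancel]

theorem add_mul_topUp_le (ha : 0 ≤ a) (hr : r ≤ S) : r + a * topUp a S r b ≤ S :=
  (add_mul_topUp ha hr).trans_le (min_le_left _ _)

end topUp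

/-- The worth at BS `other i` of the energies `f` held by the two BSs, given that BS `i` transfers
with efficiency `β`. -/
def worth (β : ℝ) (i : Fin 2) (f : Fin 2 → ℝ) : ℝ := β * f i + f (other i)

/-- The energy that the storages can deliver to BS `other i`. -/
def deliverable (α β : ℝ) (i : Fin 2) (s : Fin 2 → ℝ) : ℝ := α * worth β i s

/-- The energy drawn from the grid by both BSs. -/
def gridEnergy (u : Control) : ℝ := u.w 0 + u.w 1

/-- The two properties of a step that make it optimal when BS `other i` is in deficit: no avoidable
loss and no premature use of the grid. The term `min D (α ^ 2 * D)` is the most that the net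
energies of worth `D` can add to the deliverable energy: a surplus is charged and discharged, each
with efficiency `α`, while a deficit is taken from the deliverable energy as it is. -/
structure Thrifty (α β S : ℝ) (i : Fin 2) (s E : Fin 2 → ℝ) (u : Control) : Prop where
  efficient :
    deliverable α β i s + min (worth β i E) (α ^ 2 * worth β i E) + gridEnergy u ≤
        deliverable α β i (nextStorage α s u) ∨
      gridEnergy u = 0 ∧
        deliverable α β i (fun _ => S) ≤ deliverable α β i (nextStorage α s u)
  grid_last : gridEnergy u = 0 ∨ deliverable α β i (nextStorage α s u) = 0

section comparison

variable {α β S : ℝ} {i : Fin 2} {s s' E : Fin 2 → ℝ} {u u' : Control}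

theorem worth_mono (hβ : 0 ≤ β) : Monotone (worth β i) := fun f g h => by
  have := h i
  have := h (other i)
  unfold worth
  gcongr

theorem worth_nonneg (hβ : 0 ≤ β) {f : Fin 2 → ℝ} (hf : ∀ k, 0 ≤ f k) : 0 ≤ worth β i f :=
  add_nonneg (mul_nonneg hβ (hf i)) (hf (other i))

theorem deliverable_mono (hα : 0 ≤ α) (hβ : 0 ≤ β) : Monotone (deliverable α β i) :=
  (worth_mono hβ).const_mul hα

theorem deliverable_nonneg (hα : 0 ≤ α) (hβ : 0 ≤ β) (hs : ∀ k, 0 ≤ s k) :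
    0 ≤ deliverable α β i s :=
  mul_nonneg hα (worth_nonneg hβ hs)

theorem deliverable_nextStorage (α β : ℝ) (i : Fin 2) (s : Fin 2 → ℝ) (u : Control) :
    deliverable α β i (nextStorage α s u) =
      deliverable α β i s + α ^ 2 * worth β i u.c - α * worth β i u.d := by
  simp only [deliverable, worth, nextStorage]
  ring

theorem Feasible.gridEnergy_nonneg (h : Feasible α β S s E u) : 0 ≤ gridEnergy u :=
  add_nonneg (h.w_nonneg 0) (h.w_nonneg 1)

theorem Feasible.worth_charge_le (hβ₀ : 0 ≤ β) (hβ₁ : β ≤ 1) (i : Fin 2)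
    (h : Feasible α β S s E u) :
    worth β i u.c ≤ worth β i E + gridEnergy u + α * worth β i u.d := by
  have h_neutral_self := mul_nonneg hβ₀ (h.neutral i)
  have h_neutral_other := h.neutral (other i)
  rw [other_other] at h_neutral_other
  have h_grid_loss : 0 ≤ (1 - β) * u.w i := mul_nonneg (sub_nonneg.2 hβ₁) (h.w_nonneg i)
  have h_transfer_loss : 0 ≤ (1 - β * β) * u.x (other i) :=
    mul_nonneg (sub_nonneg.2 (mul_le_one₀ hβ₁ hβ₀ hβ₁)) (h.x_nonneg _)
  rw [gridEnergy, apply_zero_add_apply_one i]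
  unfold worth
  linarith

theorem Feasible.deliverable_nextStorage_le (hα₀ : 0 ≤ α) (hα₁ : α ≤ 1) (hβ₀ : 0 ≤ β)
    (hβ₁ : β ≤ 1) (i : Fin 2) (h : Feasible α β S s E u) :
    deliverable α β i (nextStorage α s u) ≤
      deliverable α β i s + min (worth β i E) (α ^ 2 * worth β i E) + gridEnergy u := by
  rw [deliverable_nextStorage, ← min_add_add_left, ← min_add_add_right]
  have h_charge := h.worth_charge_le hβ₀ hβ₁ i
  have h_sq_le : 0 ≤ 1 - α ^ 2 := sub_nonneg.2 (pow_le_one₀ hα₀ hα₁)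
  have h_charge_loss := mul_nonneg h_sq_le (worth_nonneg (i := i) hβ₀ h.c_nonneg)
  have h_discharge_loss :=
    mul_nonneg h_sq_le (mul_nonneg hα₀ (worth_nonneg (i := i) hβ₀ h.d_nonneg))
  have h_grid_loss := mul_nonneg h_sq_le h.gridEnergy_nonneg
  have h_stored := mul_le_mul_of_nonneg_left h_charge (sq_nonneg α)
  exact le_min (by linarith) (by linarith)

theorem Thrifty.gridEnergy_add_lag_le (hα₀ : 0 ≤ α) (hα₁ : α ≤ 1) (hβ₀ : 0 ≤ β) (hβ₁ : β ≤ 1)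
    (hu : Thrifty α β S i s E u) (hu' : Feasible α β S s' E u') :
    gridEnergy u + max 0
        (deliverable α β i (nextStorage α s' u') - deliverable α β i (nextStorage α s u)) ≤
      gridEnergy u' + max 0 (deliverable α β i s' - deliverable α β i s) := by
  have h_le := hu'.deliverable_nextStorage_le hα₀ hα₁ hβ₀ hβ₁ i
  have h_full := deliverable_mono (i := i) hα₀ hβ₀ hu'.next_le
  have h_nonneg := deliverable_nonneg (i := i) hα₀ hβ₀ hu'.next_nonneg
  have h_grid := hu'.gridEnergy_nonneg
  have h_lag_nonneg := le_max_left 0 (deliverable α β i s' - deliverable α β i s)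
  have h_lag := le_max_right 0 (deliverable α β i s' - deliverable α β i s)
  rw [← max_add_add_left]
  apply max_le
  · rcases hu.grid_last with h_none | h_empty
    · linarith
    · rcases hu.efficient with h_eff | ⟨h_none, -⟩ <;> linarith
  · rcases hu.efficient with h_eff | ⟨h_none, h_eff⟩ <;> linarith

theorem sum_gridEnergy_le_of_thrifty (hα₀ : 0 ≤ α) (hα₁ : α ≤ 1) (hβ₀ : 0 ≤ β) (hβ₁ : β ≤ 1)
    {N : ℕ} {e : Profile} {π π' : Policy}
    (hπ : ∀ t < N, Thrifty α β S i (storage α π e t) (e t) (π t e))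
    (hπ' : ∀ t < N, Feasible α β S (storage α π' e t) (e t) (π' t e)) :
    ∑ t ∈ Finset.range N, gridEnergy (π t e) ≤ ∑ t ∈ Finset.range N, gridEnergy (π' t e) := by
  suffices h_lag : ∑ t ∈ Finset.range N, gridEnergy (π t e) +
      max 0 (deliverable α β i (storage α π' e N) - deliverable α β i (storage α π e N)) ≤
        ∑ t ∈ Finset.range N, gridEnergy (π' t e) from
    le_of_add_le_of_nonneg_left h_lag (le_max_left _ _)
  induction N with
  | zero => simp [storage]
  | succ n ih =>
    have h_prev := ih (fun t ht => hπ t (by omega)) fun t ht => hπ' t (by omega)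
    have h_step := (hπ n n.lt_succ_self).gridEnergy_add_lag_le hα₀ hα₁ hβ₀ hβ₁
      (hπ' n n.lt_succ_self)
    simp only [Finset.sum_range_succ, storage]
    linarith

end comparison

/-- The net energies after BS `i` has sent the amount `x` to the other BS. -/
def afterTransfer (β : ℝ) (i : Fin 2) (x : ℝ) (E : Fin 2 → ℝ) : Fin 2 → ℝ :=
  Function.update (Function.update E i (E i - x)) (other i) (E (other i) + β * x)

/-- The control `u` with an additional transfer of the amount `x` from BS `i`. -/
noncomputable def addTransfer (i : Fin 2) (x : ℝ) (u : Control) : Control :=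
  { u with x := u.x + Pi.single i x }

section transfer

variable {α β S x : ℝ} {i : Fin 2} {s E : Fin 2 → ℝ} {u : Control}

theorem afterTransfer_self (β : ℝ) (i : Fin 2) (x : ℝ) (E : Fin 2 → ℝ) :
    afterTransfer β i x E i = E i - x := by
  simp [afterTransfer, Function.update_of_ne (other_ne i).symm]

theorem afterTransfer_other (β : ℝ) (i : Fin 2) (x : ℝ) (E : Fin 2 → ℝ) :
    afterTransfer β i x E (other i) = E (other i) + β * x := by
  simp [afterTransfer]

theorem worth_afterTransfer (β : ℝ) (i : Fin 2) (x : ℝ) (E : Fin 2 → ℝ) :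
    worth β i (afterTransfer β i x E) = worth β i E := by
  rw [worth, worth, afterTransfer_self, afterTransfer_other]
  ring

theorem Feasible.addTransfer (h : Feasible α β S s (afterTransfer β i x E) u) (hx : 0 ≤ x)
    (hu : u.x (other i) = 0) : Feasible α β S s E (addTransfer i x u) where
  __ := h
  x_nonneg k := add_nonneg (h.x_nonneg k) (single_apply_nonneg i hx k)
  one_way := by
    rw [apply_zero_mul_apply_one i]
    simp [EnergyCoop.addTransfer, hu, other_ne]
  neutral := by
    obtain ⟨h_self, h_other⟩ := (forall_iff_self_other i).1 h.neutral
    rw [afterTransfer_self] at h_self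
    rw [afterTransfer_other, other_other] at h_other
    refine (forall_iff_self_other i).2 ⟨?_, ?_⟩ <;>
      simp only [EnergyCoop.addTransfer, Pi.add_apply, other_other, Pi.single_eq_same,
        Pi.single_eq_of_ne (other_ne i)] <;>
      linarith

theorem Thrifty.addTransfer (h : Thrifty α β S i s (afterTransfer β i x E) u) :
    Thrifty α β S i s E (addTransfer i x u) where
  efficient := worth_afterTransfer β i x E ▸ h.efficient
  grid_last := h.grid_last

end transfer

/-- The control of a step without deficit in which the BSs `i` and `other i` charge the amounts
`c` and `c'` and BS `i` sends the amount `y`. -/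
noncomputable def chargeControl (i : Fin 2) (c c' y : ℝ) : Control where
  w := 0
  c := Pi.single i c + Pi.single (other i) c'
  d := 0
  x := Pi.single i y

section chargeControl

variable {α β S : ℝ} {i : Fin 2} {s E : Fin 2 → ℝ}

theorem nextStorage_chargeControl_self (α : ℝ) (i : Fin 2) (s : Fin 2 → ℝ) (c c' y : ℝ) :
    nextStorage α s (chargeControl i c c' y) i = s i + α * c := by
  simp [nextStorage, chargeControl, (other_ne i).symm]

theorem nextStorage_chargeControl_other (α : ℝ) (i : Fin 2) (s : Fin 2 → ℝ) (c c' y : ℝ) :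
    nextStorage α s (chargeControl i c c' y) (other i) = s (other i) + α * c' := by
  simp [nextStorage, chargeControl, other_ne]

theorem deliverable_nextStorage_chargeControl (α β : ℝ) (i : Fin 2) (s : Fin 2 → ℝ)
    (c c' y : ℝ) :
    deliverable α β i (nextStorage α s (chargeControl i c c' y)) =
      α * (β * (s i + α * c) + (s (other i) + α * c')) := by
  rw [deliverable, worth, nextStorage_chargeControl_self, nextStorage_chargeControl_other]

theorem feasible_chargeControl (hα : 0 ≤ α) (hs : ∀ k, 0 ≤ s k) {c c' y : ℝ} (hc : 0 ≤ c)
    (hc' : 0 ≤ c') (hy : 0 ≤ y) (h_self : c + y ≤ E i) (h_other : c' ≤ E (other i) + β * y)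
    (h_le_self : s i + α * c ≤ S) (h_le_other : s (other i) + α * c' ≤ S) :
    Feasible α β S s E (chargeControl i c c' y) where
  w_nonneg _ := le_rfl
  c_nonneg k := add_nonneg (single_apply_nonneg _ hc k) (single_apply_nonneg _ hc' k)
  d_nonneg _ := le_rfl
  x_nonneg := single_apply_nonneg i hy
  charge_or_discharge _ := mul_zero _
  one_way := by
    rw [apply_zero_mul_apply_one i]
    simp [chargeControl, other_ne]
  discharge_le := hs
  next_nonneg := by
    rw [forall_iff_self_other i, nextStorage_chargeControl_self, nextStorage_chargeControl_other]
    exact ⟨add_nonneg (hs _) (mul_nonneg hα hc), add_nonneg (hs _) (mul_nonneg hα hc')⟩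
  next_le := by
    rw [forall_iff_self_other i, nextStorage_chargeControl_self, nextStorage_chargeControl_other]
    exact ⟨h_le_self, h_le_other⟩
  neutral := by
    refine (forall_iff_self_other i).2 ⟨?_, ?_⟩ <;>
      simp only [chargeControl, Pi.add_apply, Pi.zero_apply, other_other, Pi.single_eq_same,
        Pi.single_eq_of_ne (other_ne i), Pi.single_eq_of_ne (other_ne i).symm] <;>
      linarith

end chargeControl

/-- The amounts that the storages are charged with from the net energies of their own BSs. -/
noncomputable def ownCharge (α S : ℝ) (s E : Fin 2 → ℝ) : Fin 2 → ℝ :=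
  fun k => topUp α S (s k) (E k)

/-- The energy that BS `k` has left after charging its own storage, or `0` if it cannot be
transferred. -/
noncomputable def leftover (α β S : ℝ) (s E : Fin 2 → ℝ) (k : Fin 2) : ℝ :=
  if β = 0 then 0 else E k - ownCharge α S s E k

section surplus

variable {α β S : ℝ} {i : Fin 2} {s E : Fin 2 → ℝ}

theorem surplusRule_eq_share (i : Fin 2)
    (h_full : s i + α * ownCharge α S s E i = S)
    (h_lt : s (other i) + α * ownCharge α S s E (other i) < S) :
    surplusRule α β S s E =
      { w := 0
        c := ownCharge α S s E + Pi.single (other i)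
          (topUp α S (s (other i) + α * ownCharge α S s E (other i))
            (β * leftover α β S s E i))
        d := 0
        x := Pi.single i (leftover α β S s E i) } := by
  rw [topUp, min_comm]
  match i with
  | 0 => exact if_pos ⟨h_full, h_lt⟩
  | 1 => exact (if_neg fun h => h_lt.ne h.1).trans (if_pos ⟨h_full, h_lt⟩)

theorem surplusRule_eq_ownCharge
    (h : ∀ k, ¬(s k + α * ownCharge α S s E k = S ∧
      s (other k) + α * ownCharge α S s E (other k) < S)) :
    surplusRule α β S s E = { w := 0, c := ownCharge α S s E, d := 0, x := 0 } :=
  (if_neg (h 0)).trans (if_neg (h 1))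

theorem ownCharge_nonneg (hα : 0 ≤ α) {k : Fin 2} (hs : s k ≤ S) (hE : 0 ≤ E k) :
    0 ≤ ownCharge α S s E k :=
  topUp_nonneg hα hs hE

theorem ownCharge_le (α S : ℝ) (s E : Fin 2 → ℝ) (k : Fin 2) : ownCharge α S s E k ≤ E k :=
  topUp_le

theorem add_mul_ownCharge (hα : 0 ≤ α) {k : Fin 2} (hs : s k ≤ S) :
    s k + α * ownCharge α S s E k = min S (s k + α * E k) :=
  add_mul_topUp hα hs

theorem add_mul_ownCharge_le (hα : 0 ≤ α) {k : Fin 2} (hs : s k ≤ S) :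
    s k + α * ownCharge α S s E k ≤ S :=
  add_mul_topUp_le hα hs

theorem ownCharge_eq_zero (hα : 0 ≤ α) {k : Fin 2} (hs : s k ≤ S) (hE : E k = 0) :
    ownCharge α S s E k = 0 := by
  rw [ownCharge, hE, topUp_zero_right hα hs]

theorem ownCharge_eq_single (hα : 0 ≤ α) (hs : s (other i) ≤ S) (hE : E (other i) = 0) :
    ownCharge α S s E = Pi.single i (ownCharge α S s E i) := by
  rw [funext_iff, forall_iff_self_other i]
  simp [ownCharge_eq_zero hα hs hE, other_ne]

theorem leftover_nonneg (α β S : ℝ) (s E : Fin 2 → ℝ) (k : Fin 2) :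
    0 ≤ leftover α β S s E k := by
  unfold leftover
  split_ifs
  · exact le_rfl
  · exact sub_nonneg.2 (ownCharge_le ..)

theorem ownCharge_add_leftover_le (α β S : ℝ) (s E : Fin 2 → ℝ) (k : Fin 2) :
    ownCharge α S s E k + leftover α β S s E k ≤ E k := by
  unfold leftover
  split_ifs
  · simpa using ownCharge_le α S s E k
  · simp

theorem mul_leftover (α β S : ℝ) (s E : Fin 2 → ℝ) (k : Fin 2) :
    β * leftover α β S s E k = β * (E k - ownCharge α S s E k) := by
  unfold leftover
  split_ifs with hβ <;> simp [hβ]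

theorem surplusRule_eq_chargeControl_of_full (hα : 0 ≤ α) (hs : ∀ k, s k ≤ S)
    (hE : E (other i) = 0) (h_full : s i + α * ownCharge α S s E i = S)
    (h_lt : s (other i) < S) :
    surplusRule α β S s E = chargeControl i (ownCharge α S s E i)
      (topUp α S (s (other i)) (β * leftover α β S s E i)) (leftover α β S s E i) := by
  have h_level : s (other i) + α * ownCharge α S s E (other i) = s (other i) := by
    rw [ownCharge_eq_zero hα (hs _) hE, mul_zero, add_zero]
  rw [surplusRule_eq_share i h_full (h_level.trans_lt h_lt), h_level, chargeControl,
    ← ownCharge_eq_single hα (hs _) hE]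

theorem surplusRule_eq_chargeControl_of_not_full (hα : 0 ≤ α) (hs : ∀ k, s k ≤ S)
    (hE : E (other i) = 0)
    (h : ¬(s i + α * ownCharge α S s E i = S ∧ s (other i) < S)) :
    surplusRule α β S s E = chargeControl i (ownCharge α S s E i) 0 0 := by
  have h_level : s (other i) + α * ownCharge α S s E (other i) = s (other i) := by
    rw [ownCharge_eq_zero hα (hs _) hE, mul_zero, add_zero]
  rw [chargeControl, Pi.single_zero, Pi.single_zero, add_zero, ← ownCharge_eq_single hα (hs _) hE]
  by_cases h_other : s (other i) = S ∧ s i + α * ownCharge α S s E i < S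
  · have h_none : leftover α β S s E (other i) = 0 := by
      simp [leftover, ownCharge_eq_zero hα (hs _) hE, hE]
    have h_lt : s (other (other i)) + α * ownCharge α S s E (other (other i)) < S := by
      rw [other_other]
      exact h_other.2
    rw [surplusRule_eq_share (other i) (h_level.trans h_other.1) h_lt, h_none, mul_zero,
      topUp_zero_right hα h_lt.le, Pi.single_zero, Pi.single_zero, add_zero]
  · apply surplusRule_eq_ownCharge
    rw [forall_iff_self_other i, other_other, h_level]
    exact ⟨h, h_other⟩

theorem surplusRule_x_other (hα : 0 ≤ α) (hs : ∀ k, s k ≤ S) (hE : E (other i) = 0) :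
    (surplusRule α β S s E).x (other i) = 0 := by
  by_cases h : s i + α * ownCharge α S s E i = S ∧ s (other i) < S
  · simp [surplusRule_eq_chargeControl_of_full hα hs hE h.1 h.2, chargeControl, other_ne]
  · simp [surplusRule_eq_chargeControl_of_not_full hα hs hE h, chargeControl]

theorem feasible_surplusRule (hα : 0 ≤ α) (hβ : 0 ≤ β) (hs₀ : ∀ k, 0 ≤ s k) (hs : ∀ k, s k ≤ S)
    (hE₀ : 0 ≤ E i) (hE : E (other i) = 0) : Feasible α β S s E (surplusRule α β S s E) := by
  have h_nonneg := ownCharge_nonneg hα (hs i) hE₀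
  have h_level := add_mul_ownCharge_le (E := E) hα (hs i)
  by_cases h : s i + α * ownCharge α S s E i = S ∧ s (other i) < S
  · rw [surplusRule_eq_chargeControl_of_full hα hs hE h.1 h.2]
    have h_left := leftover_nonneg α β S s E i
    refine feasible_chargeControl hα hs₀ h_nonneg (topUp_nonneg hα (hs _) (mul_nonneg hβ h_left))
      h_left (ownCharge_add_leftover_le ..) ?_ h_level (add_mul_topUp_le hα (hs _))
    rw [hE, zero_add]
    exact topUp_le
  · rw [surplusRule_eq_chargeControl_of_not_full hα hs hE h]
    apply feasible_chargeControl hα hs₀ h_nonneg le_rfl le_rfl <;>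
      simp [ownCharge_le, h_level, hE, hs]

theorem gridEnergy_surplusRule (α β S : ℝ) (s E : Fin 2 → ℝ) :
    gridEnergy (surplusRule α β S s E) = 0 := by
  unfold surplusRule gridEnergy
  dsimp only
  split_ifs <;> simp

theorem surplusRule_efficient (hα : 0 ≤ α) (hs : ∀ k, s k ≤ S) (hE : E (other i) = 0) :
    deliverable α β i (nextStorage α s (surplusRule α β S s E)) =
        deliverable α β i s + α ^ 2 * worth β i E ∨
      deliverable α β i (nextStorage α s (surplusRule α β S s E)) =
        deliverable α β i (fun _ => S) := by
  have h_next := add_mul_ownCharge (E := E) hα (hs i)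
  by_cases h : s i + α * ownCharge α S s E i = S ∧ s (other i) < S
  · rw [surplusRule_eq_chargeControl_of_full hα hs hE h.1 h.2,
      deliverable_nextStorage_chargeControl, add_mul_topUp hα (hs _), mul_leftover]
    rcases min_choice S (s (other i) + α * (β * (E i - ownCharge α S s E i))) with h_min | h_min
    · right
      rw [h_min, h.1, deliverable, worth]
    · left
      rw [h_min, deliverable, worth, worth, hE]
      ring
  · rw [surplusRule_eq_chargeControl_of_not_full hα hs hE h,
      deliverable_nextStorage_chargeControl]
    rcases min_choice S (s i + α * E i) with h_min | h_min
    · right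
      have h_full : s (other i) = S :=
        (hs _).eq_of_not_lt fun h_lt => h ⟨h_next.trans h_min, h_lt⟩
      rw [h_next, h_min, h_full, mul_zero, add_zero, deliverable, worth]
    · left
      rw [h_next, h_min, deliverable, worth, worth, hE]
      ring

theorem thrifty_surplusRule (hα : 0 ≤ α) (hs : ∀ k, s k ≤ S) (hE : E (other i) = 0) :
    Thrifty α β S i s E (surplusRule α β S s E) where
  efficient := by
    rw [gridEnergy_surplusRule, add_zero]
    refine (surplusRule_efficient hα hs hE).imp (fun h => ?_) fun h => ⟨rfl, h.ge⟩
    rw [h]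
    gcongr
    exact min_le_right _ _
  grid_last := Or.inl (gridEnergy_surplusRule ..)

end surplus

/-- The control that covers the deficit of BS `other i` from its own storage first, then from the
storage of BS `i`, and finally from the grid. -/
noncomputable def dischargeControl (α β : ℝ) (i : Fin 2) (s E : Fin 2 → ℝ) : Control :=
  let d' := topUp α 0 (E (other i)) (s (other i))
  let d := topUp (α * β) 0 (E (other i) + α * d') (s i)
  { w := Pi.single (other i) (-(E (other i) + α * d' + α * β * d))
    c := 0
    d := Pi.single (other i) d' + Pi.single i d
    x := Pi.single i (α * d) }

section dischargeControl

variable {α β S : ℝ} {i : Fin 2} {s E : Fin 2 → ℝ}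

theorem dischargeControl_of_eq_zero (hs : 0 ≤ s i)
    (h : E (other i) + α * topUp α 0 (E (other i)) (s (other i)) = 0) :
    dischargeControl α β i s E =
      { w := 0
        c := 0
        d := Pi.single (other i) (topUp α 0 (E (other i)) (s (other i)))
        x := 0 } := by
  simp [dischargeControl, h, topUp_self hs]

theorem dischargeControl_w (hα : 0 ≤ α) (hβ : 0 ≤ β) (hs : ∀ k, 0 ≤ s k)
    (hE : E (other i) ≤ 0) :
    (dischargeControl α β i s E).w =
      Pi.single (other i) (-min 0 (E (other i) + deliverable α β i s)) := by
  have h_reserve : 0 ≤ α * β * s i := mul_nonneg (mul_nonneg hα hβ) (hs i)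
  rw [dischargeControl]
  dsimp only
  rw [add_mul_topUp (mul_nonneg hα hβ) (add_mul_topUp_le hα hE), add_mul_topUp hα hE,
    ← min_add_add_right, ← min_assoc, zero_add, min_eq_left h_reserve, deliverable, worth]
  ring_nf

theorem gridEnergy_dischargeControl (hα : 0 ≤ α) (hβ : 0 ≤ β) (hs : ∀ k, 0 ≤ s k)
    (hE : E (other i) ≤ 0) :
    gridEnergy (dischargeControl α β i s E) = -min 0 (E (other i) + deliverable α β i s) := by
  rw [gridEnergy, apply_zero_add_apply_one i, dischargeControl_w hα hβ hs hE]
  simp [(other_ne i).symm]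

theorem deliverable_nextStorage_dischargeControl (α β : ℝ) (i : Fin 2) (s E : Fin 2 → ℝ) :
    deliverable α β i (nextStorage α s (dischargeControl α β i s E)) =
      deliverable α β i s + E (other i) + gridEnergy (dischargeControl α β i s E) := by
  rw [deliverable_nextStorage, gridEnergy, apply_zero_add_apply_one i]
  simp only [dischargeControl, worth, Pi.add_apply, Pi.zero_apply, Pi.single_eq_same,
    Pi.single_eq_of_ne (other_ne i), Pi.single_eq_of_ne (other_ne i).symm]
  ring

theorem feasible_dischargeControl (hα : 0 ≤ α) (hβ : 0 ≤ β) (hs₀ : ∀ k, 0 ≤ s k)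
    (hs : ∀ k, s k ≤ S) (hE₀ : 0 ≤ E i) (hE : E (other i) ≤ 0) :
    Feasible α β S s E (dischargeControl α β i s E) := by
  have h_discharge : ∀ k, 0 ≤ (dischargeControl α β i s E).d k ∧
      (dischargeControl α β i s E).d k ≤ s k := by
    rw [forall_iff_self_other i]
    simp [dischargeControl, other_ne, (other_ne i).symm, topUp_le, topUp_nonneg hα hE (hs₀ _),
      topUp_nonneg (mul_nonneg hα hβ) (add_mul_topUp_le hα hE) (hs₀ _)]
  exact {
    w_nonneg := by
      rw [dischargeControl_w hα hβ hs₀ hE]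
      exact single_apply_nonneg _ (neg_nonneg.2 (min_le_left _ _))
    c_nonneg := fun _ => le_rfl
    d_nonneg := fun k => (h_discharge k).1
    x_nonneg := single_apply_nonneg _ (mul_nonneg hα
      (topUp_nonneg (mul_nonneg hα hβ) (add_mul_topUp_le hα hE) (hs₀ _)))
    charge_or_discharge := fun _ => zero_mul _
    one_way := by
      rw [apply_zero_mul_apply_one i]
      simp [dischargeControl, other_ne]
    discharge_le := fun k => (h_discharge k).2
    next_nonneg := fun k => by
      simpa [nextStorage, dischargeControl] using (h_discharge k).2
    next_le := fun k => by
      have h_own : nextStorage α s (dischargeControl α β i s E) k =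
          s k - (dischargeControl α β i s E).d k := by simp [nextStorage, dischargeControl]
      linarith [hs k, (h_discharge k).1]
    neutral := by
      refine (forall_iff_self_other i).2 ⟨?_, ?_⟩ <;>
        simp only [dischargeControl, Pi.add_apply, Pi.zero_apply, other_other, Pi.single_eq_same,
          Pi.single_eq_of_ne (other_ne i), Pi.single_eq_of_ne (other_ne i).symm] <;>
        linarith }

theorem thrifty_dischargeControl (hα : 0 ≤ α) (hβ : 0 ≤ β) (hs : ∀ k, 0 ≤ s k)
    (hE : E (other i) ≤ 0) (h_worth : worth β i E = E (other i)) :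
    Thrifty α β S i s E (dischargeControl α β i s E) where
  efficient := by
    left
    rw [deliverable_nextStorage_dischargeControl, h_worth]
    gcongr
    exact min_le_left _ _
  grid_last := by
    rw [deliverable_nextStorage_dischargeControl, gridEnergy_dischargeControl hα hβ hs hE]
    rcases min_choice 0 (E (other i) + deliverable α β i s) with h_min | h_min <;> rw [h_min]
    · exact Or.inl neg_zero
    · right
      ring

end dischargeControl

/-- The net energies left after the first stage of the greedy policy, in which BS `i` covers the
deficit of BS `other i` with its surplus. -/
noncomputable def residual (β : ℝ) (i : Fin 2) (E : Fin 2 → ℝ) : Fin 2 → ℝ :=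
  afterTransfer β i (topUp β 0 (E (other i)) (E i)) E

section transferFirst

variable {α β S : ℝ} {i : Fin 2} {s E : Fin 2 → ℝ}

theorem residual_self_nonneg (β : ℝ) (i : Fin 2) (E : Fin 2 → ℝ) : 0 ≤ residual β i E i := by
  rw [residual, afterTransfer_self]
  exact sub_nonneg.2 topUp_le

theorem residual_other (hβ : 0 ≤ β) (hE : E (other i) ≤ 0) :
    residual β i E (other i) = min 0 (E (other i) + β * E i) := by
  rw [residual, afterTransfer_other, add_mul_topUp hβ hE]

theorem residual_other_nonpos (hβ : 0 ≤ β) (hE : E (other i) ≤ 0) :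
    residual β i E (other i) ≤ 0 :=
  (residual_other hβ hE).trans_le (min_le_left _ _)

theorem worth_residual_of_ne (hβ : 0 ≤ β) (hE : E (other i) ≤ 0)
    (h : residual β i E (other i) ≠ 0) :
    worth β i (residual β i E) = residual β i E (other i) := by
  rw [residual_other hβ hE] at h ⊢
  rw [residual, worth_afterTransfer, worth, (min_choice _ _).resolve_left h, add_comm]

theorem transferFirstRule_eq_addTransfer (hα : 0 ≤ α) (hβ : 0 ≤ β) (hs : 0 ≤ s i)
    (hE : E (other i) ≤ 0) :
    transferFirstRule α β S i s E = addTransfer i (topUp β 0 (E (other i)) (E i))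
      (if residual β i E (other i) = 0 then surplusRule α β S s (residual β i E)
        else dischargeControl α β i s (residual β i E)) := by
  have h_residual : E (other i) + β * topUp β 0 (E (other i)) (E i) = residual β i E (other i) :=
    (afterTransfer_other ..).symm
  have h_nonpos := residual_other_nonpos hβ hE
  have h_nonpos' := add_mul_topUp_le (b := s (other i)) hα h_nonpos
  unfold transferFirstRule
  dsimp only
  rw [min_comm, min_abs_div_eq_topUp hE, h_residual, min_abs_div_eq_topUp h_nonpos,
    min_abs_div_eq_topUp h_nonpos',
    ite_abs_eq_neg (add_mul_topUp_le (mul_nonneg hα hβ) h_nonpos')]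
  split_ifs with h_covered h_stored
  · rw [← h_residual]
    rfl
  · simp [dischargeControl_of_eq_zero hs h_stored, addTransfer]
  · rw [add_comm (topUp β _ _ _), Pi.single_add]
    rfl

theorem feasible_transferFirstRule (hα : 0 ≤ α) (hβ : 0 ≤ β) (hs₀ : ∀ k, 0 ≤ s k)
    (hs : ∀ k, s k ≤ S) (hE₀ : 0 ≤ E i) (hE : E (other i) ≤ 0) :
    Feasible α β S s E (transferFirstRule α β S i s E) := by
  rw [transferFirstRule_eq_addTransfer hα hβ (hs₀ i) hE]
  have h_transfer := topUp_nonneg hβ hE hE₀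
  split_ifs with h
  · exact (feasible_surplusRule hα hβ hs₀ hs (residual_self_nonneg ..) h).addTransfer h_transfer
      (surplusRule_x_other hα hs h)
  · refine (feasible_dischargeControl hα hβ hs₀ hs (residual_self_nonneg ..)
      (residual_other_nonpos hβ hE)).addTransfer h_transfer ?_
    simp [dischargeControl, other_ne]

theorem thrifty_transferFirstRule (hα : 0 ≤ α) (hβ : 0 ≤ β) (hs₀ : ∀ k, 0 ≤ s k)
    (hs : ∀ k, s k ≤ S) (hE : E (other i) ≤ 0) :
    Thrifty α β S i s E (transferFirstRule α β S i s E) := by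
  rw [transferFirstRule_eq_addTransfer hα hβ (hs₀ i) hE]
  apply Thrifty.addTransfer
  split_ifs with h
  · exact thrifty_surplusRule hα hs h
  · exact thrifty_dischargeControl hα hβ hs₀ (residual_other_nonpos hβ hE)
      (worth_residual_of_ne hβ hE h)

end transferFirst

section policy

variable {α β S : ℝ} {i : Fin 2} {N : ℕ} {e : Profile}

theorem storage_modifiedGreedy (α β S : ℝ) (i : Fin 2) (e : Profile) (t : ℕ) :
    storage α (modifiedGreedy α β S i) e t = greedyStorage α β S i e t := by
  induction t with
  | zero => rfl
  | succ t ih => simp only [storage, greedyStorage, ih, modifiedGreedy]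

theorem greedyStorage_bounds (hα : 0 ≤ α) (hβ : 0 ≤ β) (hS : 0 ≤ S) {t : ℕ}
    (he : ∀ t' < t, 0 ≤ e t' i ∧ e t' (other i) ≤ 0) :
    (∀ k, 0 ≤ greedyStorage α β S i e t k) ∧ ∀ k, greedyStorage α β S i e t k ≤ S := by
  induction t with
  | zero => exact ⟨fun _ => le_rfl, fun _ => hS⟩
  | succ t ih =>
    obtain ⟨h_nonneg, h_le⟩ := ih fun t' ht' => he t' (by omega)
    have h_sign := he t t.lt_succ_self
    have h := feasible_transferFirstRule hα hβ h_nonneg h_le h_sign.1 h_sign.2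
    exact ⟨h.next_nonneg, h.next_le⟩

theorem feasible_modifiedGreedy (hα : 0 ≤ α) (hβ : 0 ≤ β) (hS : 0 ≤ S)
    (he : ∀ t < N, 0 ≤ e t i ∧ e t (other i) ≤ 0) :
    ∀ t < N, Feasible α β S (storage α (modifiedGreedy α β S i) e t) (e t)
      (modifiedGreedy α β S i t e) := fun t ht => by
  obtain ⟨h_nonneg, h_le⟩ := greedyStorage_bounds (t := t) hα hβ hS fun t' ht' => he t' (by omega)
  rw [storage_modifiedGreedy]
  exact feasible_transferFirstRule hα hβ h_nonneg h_le (he t ht).1 (he t ht).2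

theorem thrifty_modifiedGreedy (hα : 0 ≤ α) (hβ : 0 ≤ β) (hS : 0 ≤ S)
    (he : ∀ t < N, 0 ≤ e t i ∧ e t (other i) ≤ 0) :
    ∀ t < N, Thrifty α β S i (storage α (modifiedGreedy α β S i) e t) (e t)
      (modifiedGreedy α β S i t e) := fun t ht => by
  obtain ⟨h_nonneg, h_le⟩ := greedyStorage_bounds (t := t) hα hβ hS fun t' ht' => he t' (by omega)
  rw [storage_modifiedGreedy]
  exact thrifty_transferFirstRule hα hβ h_nonneg h_le (he t ht).2

theorem greedyStorage_congr (α β S : ℝ) (i : Fin 2) {e e' : Profile} {t : ℕ}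
    (h : ∀ k < t, e k = e' k) : greedyStorage α β S i e t = greedyStorage α β S i e' t := by
  induction t with
  | zero => rfl
  | succ t ih => simp only [greedyStorage, ih fun k hk => h k (by omega), h t t.lt_succ_self]

end policy

/-- The σ-algebra for which the measurable control-valued maps are those with measurable
components. -/
instance : MeasurableSpace Control :=
  MeasurableSpace.comap (fun u => (u.w, u.c, u.d, u.x)) inferInstance

section measurability

variable {Ω : Type*} [MeasurableSpace Ω]

theorem measurable_control_components : Measurable fun u : Control => (u.w, u.c, u.d, u.x) :=
  comap_measurable _

@[fun_prop]
theorem measurable_w : Measurable Control.w := measurable_control_components.fst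

@[fun_prop]
theorem measurable_c : Measurable Control.c := measurable_control_components.snd.fst

@[fun_prop]
theorem measurable_d : Measurable Control.d := measurable_control_components.snd.snd.fst

@[fun_prop]
theorem measurable_x : Measurable Control.x := measurable_control_components.snd.snd.snd

@[fun_prop]
theorem measurable_control_mk {w c d x : Ω → Fin 2 → ℝ} (hw : Measurable w) (hc : Measurable c)
    (hd : Measurable d) (hx : Measurable x) :
    Measurable fun ω => Control.mk (w ω) (c ω) (d ω) (x ω) :=
  measurable_comap_iff.2 (hw.prodMk (hc.prodMk (hd.prodMk hx)))

@[fun_prop]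
theorem measurable_single (i : Fin 2) : Measurable fun y : ℝ => (Pi.single i y : Fin 2 → ℝ) :=
  measurable_update 0

@[fun_prop]
theorem measurable_ownCharge (α S : ℝ) {s E : Ω → Fin 2 → ℝ} (hs : Measurable s)
    (hE : Measurable E) : Measurable fun ω => ownCharge α S (s ω) (E ω) := by
  unfold ownCharge topUp
  fun_prop

@[fun_prop]
theorem measurable_leftover (α β S : ℝ) {s E : Ω → Fin 2 → ℝ} (hs : Measurable s)
    (hE : Measurable E) (k : Fin 2) : Measurable fun ω => leftover α β S (s ω) (E ω) k := by
  unfold leftover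
  split_ifs <;> fun_prop

@[fun_prop]
theorem measurable_surplusRule (α β S : ℝ) {s E : Ω → Fin 2 → ℝ} (hs : Measurable s)
    (hE : Measurable E) : Measurable fun ω => surplusRule α β S (s ω) (E ω) := by
  have h_level (k : Fin 2) : Measurable fun ω => s ω k + α * ownCharge α S (s ω) (E ω) k := by
    fun_prop
  have h_share (k : Fin 2) : Measurable fun ω =>
      { w := 0
        c := ownCharge α S (s ω) (E ω) + Pi.single (other k) (min (β * leftover α β S (s ω) (E ω) k)
          ((S - (s ω (other k) + α * ownCharge α S (s ω) (E ω) (other k))) / α))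
        d := 0
        x := Pi.single k (leftover α β S (s ω) (E ω) k) : Control } := by
    fun_prop
  have h_full_set (k l : Fin 2) : MeasurableSet {ω | s ω k + α * ownCharge α S (s ω) (E ω) k = S ∧
      s ω l + α * ownCharge α S (s ω) (E ω) l < S} :=
    (measurableSet_eq_fun (h_level k) measurable_const).inter
      (measurableSet_lt (h_level l) measurable_const)
  exact .ite (h_full_set 0 1) (h_share 0) (.ite (h_full_set 1 0) (h_share 1) (by fun_prop))

@[fun_prop]
theorem measurable_transferFirstRule (α β S : ℝ) (i : Fin 2) {s E : Ω → Fin 2 → ℝ}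
    (hs : Measurable s) (hE : Measurable E) :
    Measurable fun ω => transferFirstRule α β S i (s ω) (E ω) := by
  have h_shortfall {f : Ω → ℝ} (hf : Measurable f) :
      Measurable fun ω => if f ω < 0 then |f ω| else 0 :=
    hf.abs.ite (measurableSet_lt hf measurable_const) measurable_const
  unfold transferFirstRule
  refine .ite (measurableSet_eq_fun ?_ ?_) ?_ (.ite (measurableSet_eq_fun ?_ ?_) ?_
    (measurable_control_mk ((measurable_single _).comp (h_shortfall ?_)) ?_ ?_ ?_)) <;>
    fun_prop

@[fun_prop]
theorem measurable_nextStorage (α : ℝ) {s : Ω → Fin 2 → ℝ} {u : Ω → Control} (hs : Measurable s)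
    (hu : Measurable u) : Measurable fun ω => nextStorage α (s ω) (u ω) := by
  unfold nextStorage
  fun_prop

@[fun_prop]
theorem measurable_greedyStorage (α β S : ℝ) (i : Fin 2) (t : ℕ) :
    Measurable fun e => greedyStorage α β S i e t := by
  induction t with
  | zero => exact measurable_const
  | succ t ih =>
    unfold greedyStorage
    fun_prop

@[fun_prop]
theorem measurable_modifiedGreedy (α β S : ℝ) (i : Fin 2) (t : ℕ) :
    Measurable fun e => modifiedGreedy α β S i t e := by
  unfold modifiedGreedy
  fun_prop

end measurability

theorem admissible_modifiedGreedy {α β S : ℝ} (hα : 0 ≤ α) (hβ : 0 ≤ β) (hS : 0 ≤ S) {N : ℕ}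
    {F : Measure Profile} {i : Fin 2} (hF : ∀ᵐ e ∂F, ∀ t < N, 0 ≤ e t i ∧ e t (other i) ≤ 0) :
    Admissible α β S N F (modifiedGreedy α β S i) where
  measurable_w _ _ _ := by fun_prop
  measurable_c _ _ _ := by fun_prop
  measurable_d _ _ _ := by fun_prop
  measurable_x _ _ _ := by fun_prop
  causal t _ e e' h := by
    rw [modifiedGreedy, modifiedGreedy, greedyStorage_congr α β S i fun k hk => h k hk.le,
      h t le_rfl]
  feasible := hF.mono fun _ he => feasible_modifiedGreedy hα hβ hS he

theorem expectedCost_le_of_ae_sum_gridEnergy_le {N : ℕ} {F : Measure Profile} {π π' : Policy}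
    (h : ∀ᵐ e ∂F, ∑ t ∈ Finset.range N, gridEnergy (π t e) ≤
      ∑ t ∈ Finset.range N, gridEnergy (π' t e)) :
    expectedCost N F π ≤ expectedCost N F π' :=
  lintegral_mono_ae <| h.mono fun _ he =>
    ENNReal.ofReal_le_ofReal (mul_le_mul_of_nonneg_left he (by positivity))

end EnergyCoop

theorem mainTheorem4_general (α β S : ℝ) (hα₀ : 0 ≤ α) (hα₁ : α ≤ 1) (hβ₀ : 0 ≤ β) (hβ₁ : β ≤ 1)
    (hS : 0 ≤ S) (N : ℕ) (F : MeasureTheory.Measure EnergyCoop.Profile) (i : Fin 2)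
    (hF : ∀ᵐ e ∂F, ∀ t < N, 0 ≤ e t i ∧ e t (EnergyCoop.other i) ≤ 0) :
    EnergyCoop.IsOptimal α β S N F (EnergyCoop.modifiedGreedy α β S i) := by
  refine ⟨EnergyCoop.admissible_modifiedGreedy hα₀ hβ₀ hS hF, fun π hπ =>
    EnergyCoop.expectedCost_le_of_ae_sum_gridEnergy_le ?_⟩
  filter_upwards [hF, hπ.feasible] with e he h_feasible
  exact EnergyCoop.sum_gridEnergy_le_of_thrifty hα₀ hα₁ hβ₀ hβ₁
    (EnergyCoop.thrifty_modifiedGreedy hα₀ hβ₀ hS he) h_feasible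

theorem mainTheorem4 (α β S : ℝ) (hα₀ : 0 ≤ α) (hα₁ : α ≤ 1) (hβ₀ : 0 ≤ β) (hβ₁ : β ≤ 1)
    (hS : 0 ≤ S) (N : ℕ) (F : MeasureTheory.Measure EnergyCoop.Profile)
    [MeasureTheory.IsProbabilityMeasure F] :
    ((∀ᵐ e ∂F, ∀ t < N, 0 ≤ e t 0 ∧ e t 1 ≤ 0) →
      EnergyCoop.IsOptimal α β S N F (EnergyCoop.modifiedGreedy α β S 0)) ∧
    ((∀ᵐ e ∂F, ∀ t < N, 0 ≤ e t 1 ∧ e t 0 ≤ 0) →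
      EnergyCoop.IsOptimal α β S N F (EnergyCoop.modifiedGreedy α β S 1)) :=
  ⟨mainTheorem4_general α β S hα₀ hα₁ hβ₀ hβ₁ hS N F 0,
    mainTheorem4_general α β S hα₀ hα₁ hβ₀ hβ₁ hS N F 1⟩
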